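/- \textbf{Proposition (Classical--quantum case).} All Hilbert spaces are complex, finite-dimensional and nonzero. Let $f:(0,\infty)\to\mathbb{R}$ be operator anti-monotone, i.e. $A\le B$ implies $f(B)\le f(A)$ for all positive definite complex matrices $A,B$ of every finite size. For a positive semi-definite operator $X$ and positive definite operators $W,\tau$ on a Hilbert space $\mathcal{H}_S$ with a fixed orthonormal basis $\{|i\rangle\}_i$, let \[ \widetilde{Q}_f(X\Vert W;\tau)=\langle\varphi^X|\,f(\tau^{-1}\otimes W^{T})\,|\varphi^X\rangle,\qquad |\varphi^X\rangle=(X^{1/2}\otimes I)\sum_i|i\rangle|i\rangle, \] where $T$ is the transpose with respect to $\{|i\rangle\}_i$. For positive semi-definite $X,Y$ on $\mathcal{H}_S$, let $\Pi_Y^{\perp}$ be the orthogonal projection onto the kernel of $Y$ and let \[ \widetilde{Q}_f(X\Vert Y)=\sup_{\tau>0,\ \operatorname{Tr}\tau\le 1,\ \varepsilon>0}\widetilde{Q}_f(X\Vert Y+\varepsilon\Pi_Y^{\perp};\tau)\in(-\infty,+\infty]. \] Let $\{|z\rangle\}_z$ be an orthonormal basis of $\mathcal{H}_Z$, let $\{X^z\}_z$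 and $\{Y^z\}_z$ be families of positive semi-definite operators on $\mathcal{H}_A$, and let \[ X=\sum_z|z\rangle\langle z|\otimes X^z,\qquad Y=\sum_z|z\rangle\langle z|\otimes Y^z . \] Then, as an equality in $(-\infty,+\infty]$, \[ \widetilde{Q}_f(X\Vert Y)=\sup_{\{\hat\tau^z\}_z,\ \varepsilon>0}\ \sum_z\widetilde{Q}_f\bigl(X^z\Vert Y^z+\varepsilon\Pi_{Y^z}^{\perp};\hat\tau^z\bigr), \] where the supremum is over all $\varepsilon>0$ and all families of positive definite operators $\hat\tau^z$ on $\mathcal{H}_A$ with $\sum_z\operatorname{Tr}\hat\tau^z=1$. -/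

import Mathlib

open scoped ComplexOrder MatrixOrder Kronecker

noncomputable section

/-- `f : (0, ∞) → ℝ` is operator anti-monotone: `A ≤ B` implies `f(B) ≤ f(A)` for all positive
definite complex matrices `A`, `B` of every finite size. Here `≤` is the Loewner order, and only
the values of `f` on `(0, ∞)` matter. -/
def IsOperatorAntitone (f : ℝ → ℝ) : Prop :=
  ∀ (n : ℕ) (A B : Matrix (Fin n) (Fin n) ℂ), A.PosDef → B.PosDef → A ≤ B → cfc f B ≤ cfc f A

section Divergence

variable {n : Type*} [Fintype n] [DecidableEq n]

/-- The unnormalized maximally entangled vector `|Γ⟩ = ∑ i, |i⟩|i⟩` in `ℂⁿ ⊗ ℂⁿ`. -/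
def gammaVec (n : Type*) [DecidableEq n] : n × n → ℂ :=
  fun p => if p.1 = p.2 then 1 else 0

/-- The vector `|φ^X⟩ = (X^{1/2} ⊗ I)|Γ⟩`. -/
def phiVec (X : Matrix n n ℂ) : n × n → ℂ :=
  (CFC.sqrt X ⊗ₖ (1 : Matrix n n ℂ)).mulVec (gammaVec n)

/-- `Q̃_f(X‖Z; τ) = ⟨φ^X| f(τ⁻¹ ⊗ Zᵀ) |φ^X⟩`, for positive definite `Z` and `τ`. The matrix
`f(τ⁻¹ ⊗ Zᵀ)` is Hermitian, so that the expectation is real and `.re` loses nothing. -/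
def optFDivAt (f : ℝ → ℝ) (X Z τ : Matrix n n ℂ) : ℝ :=
  (star (phiVec X) ⬝ᵥ (cfc f (τ⁻¹ ⊗ₖ Z.transpose)).mulVec (phiVec X)).re

/-- The matrix of the orthogonal projection of `ℂⁿ` onto the kernel of `Y`. -/
def kerProj (Y : Matrix n n ℂ) : Matrix n n ℂ :=
  (Matrix.toEuclideanCLM (n := n) (𝕜 := ℂ)).symm
    (LinearMap.ker (Matrix.toEuclideanCLM (n := n) (𝕜 := ℂ) Y).toLinearMap).starProjection

/-- The optimized quantum `f`-divergence, with values in the extended reals: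
the supremum of `Q̃_f(X‖Y + ε Π_Y^⊥; τ)` over `ε > 0` and `τ > 0` with `Tr τ ≤ 1`. -/
def optFDiv (f : ℝ → ℝ) (X Y : Matrix n n ℂ) : EReal :=
  ⨆ (τ : Matrix n n ℂ) (ε : ℝ) (_ : τ.PosDef ∧ τ.trace.re ≤ 1 ∧ 0 < ε),
    ((optFDivAt f X (Y + (ε : ℂ) • kerProj Y) τ : ℝ) : EReal)

end Divergence

/-- The classical-quantum operator `∑ z, |z⟩⟨z| ⊗ X^z`, for an orthonormal basis `|z⟩`. -/
def cqOp {Z A : Type*} [Fintype Z]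
    (b : OrthonormalBasis Z ℂ (EuclideanSpace ℂ Z)) (X : Z → Matrix A A ℂ) :
    Matrix (Z × A) (Z × A) ℂ :=
  ∑ z, Matrix.vecMulVec (b z).ofLp (star (b z).ofLp) ⊗ₖ X z

end

/-! Expanding in eigenvectors `u j` of the second argument, with eigenvalues `w j`, turns the
divergence into a sum of expectations of `f (w j • τ⁻¹)` in the vectors `√X u j`
(`optFDivAt_eq_sum`). For classical-quantum operators these vectors lie in the blocks, so each
expectation sees only a compression by the isometry `V = |z⟩ ⊗ I`.

A block-diagonal `τ` therefore gives exactly the sum of the block divergences, which is one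
inequality. For the other, `t ↦ f (1/t)` is operator monotone, hence satisfies the Jensen-type bound
`Vᴴ f(w τ⁻¹) V ≤ f(w (Vᴴ τ V)⁻¹)`: passing to the diagonal blocks of `τ` only increases the value,
and so does rescaling them to total trace one, since `Tr τ ≤ 1`.

The bound is first proved with a factor `c < 1` in the argument of `f` (`compression_le_scaled`).
Letting `c → 1` needs left continuity of `f`, which is not assumed: it is extracted from the scaled
bound in dimension two. -/

open Matrix Filter Topology

namespace Matrix

/-! ### Functional calculus and intertwiners -/

section CfcIntertwining

variable {m n : Type*} [Fintype m] [DecidableEq m] [Fintype n] [DecidableEq n]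

/-- If `V` intertwines two Hermitian matrices, then it intertwines their images under the
functional calculus. -/
lemma cfc_mul_eq_mul_cfc {M : Matrix m m ℂ} {N : Matrix n n ℂ} {V : Matrix m n ℂ}
    (hM : M.IsHermitian) (hN : N.IsHermitian) (h : M * V = V * N) (f : ℝ → ℝ) :
    cfc f M * V = V * cfc f N := by
  have hfin : (spectrum ℝ M ∪ spectrum ℝ N).Finite :=
    M.finite_real_spectrum.union N.finite_real_spectrum
  -- Both spectra are finite, so one polynomial represents `f` on their union and `f` need not be
  -- continuous.
  set p : Polynomial ℝ := Lagrange.interpolate hfin.toFinset id f with hp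
  have hev : ∀ x ∈ spectrum ℝ M ∪ spectrum ℝ N, f x = p.eval x := fun x hx => by
    rw [hp]
    exact (Lagrange.eval_interpolate_at_node (v := id) f (Function.injective_id.injOn)
      (hfin.mem_toFinset.2 hx)).symm
  rw [cfc_congr (fun x hx => hev x (Or.inl hx)), cfc_congr (fun x hx => hev x (Or.inr hx)),
    cfc_polynomial p M hM.isSelfAdjoint, cfc_polynomial p N hN.isSelfAdjoint]
  have hpow : ∀ k : ℕ, M ^ k * V = V * N ^ k := fun k => by
    induction k with
    | zero => simp
    | succ k ih => rw [pow_succ, pow_succ, Matrix.mul_assoc, h, ← Matrix.mul_assoc, ih,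
        Matrix.mul_assoc]
  simp only [Polynomial.aeval_eq_sum_range, Matrix.sum_mul, Matrix.mul_sum, Matrix.smul_mul,
    Matrix.mul_smul, hpow]

/-- If `V` intertwines two positive semidefinite matrices, then it intertwines their square
roots. -/
lemma sqrt_mul_eq_mul_sqrt {M : Matrix m m ℂ} {N : Matrix n n ℂ} {V : Matrix m n ℂ}
    (hM : M.PosSemidef) (hN : N.PosSemidef) (h : M * V = V * N) :
    CFC.sqrt M * V = V * CFC.sqrt N := by
  rw [CFC.sqrt_eq_cfc, CFC.sqrt_eq_cfc, cfc_nnreal_eq_real _ M hM.nonneg,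
    cfc_nnreal_eq_real _ N hN.nonneg]
  exact cfc_mul_eq_mul_cfc hM.1 hN.1 h _

lemma cfc_submatrix_equiv {M : Matrix n n ℂ} (hM : M.IsHermitian) (e : m ≃ n) (f : ℝ → ℝ) :
    cfc f (M.submatrix e e) = (cfc f M).submatrix e e := by
  have h : M.submatrix e e * (1 : Matrix n n ℂ).submatrix e id =
      (1 : Matrix n n ℂ).submatrix e id * M := by
    ext i j
    obtain ⟨j, rfl⟩ := e.surjective j
    simp [Matrix.mul_apply, Matrix.one_apply, e.injective.eq_iff]
  have h2 := cfc_mul_eq_mul_cfc (hM.submatrix e) hM h f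
  ext i j
  have h3 := congrFun (congrFun h2 i) (e j)
  simpa [Matrix.mul_apply, Matrix.one_apply, e.injective.eq_iff] using h3

/-- Inversion is antitone on positive definite matrices. -/
lemma PosDef.inv_le_inv {A B : Matrix n n ℂ} (hA : A.PosDef) (hB : B.PosDef) (h : A ≤ B) :
    B⁻¹ ≤ A⁻¹ := by
  have hAu : IsUnit A.det := (Matrix.isUnit_iff_isUnit_det A).1 hA.isUnit
  have hBu : IsUnit B.det := (Matrix.isUnit_iff_isUnit_det B).1 hB.isUnit
  have hD : (B - A).PosSemidef := Matrix.le_iff.1 h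
  rw [Matrix.le_iff]
  -- The resolvent identity applied twice yields a sum of two congruences of positive semidefinite
  -- matrices.
  have key : A⁻¹ - B⁻¹ = B⁻¹ * (B - A) * B⁻¹ + B⁻¹ * (B - A) * A⁻¹ * ((B - A) * B⁻¹) := by
    simp only [Matrix.mul_sub, Matrix.sub_mul, Matrix.nonsing_inv_mul _ hBu,
      Matrix.mul_nonsing_inv _ hBu, Matrix.one_mul, Matrix.mul_one,
      Matrix.mul_nonsing_inv_cancel_right _ _ hAu, Matrix.mul_assoc,
      Matrix.nonsing_inv_mul_cancel_left _ _ hAu]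
    abel
  have hBi : (B⁻¹)ᴴ = B⁻¹ := hB.inv.1
  rw [key]
  refine Matrix.PosSemidef.add ?_ ?_
  · simpa only [hBi] using hD.conjTranspose_mul_mul_same B⁻¹
  · have := hA.inv.posSemidef.conjTranspose_mul_mul_same ((B - A) * B⁻¹)
    rwa [Matrix.conjTranspose_mul, hBi, hD.1] at this

end CfcIntertwining

section QuadraticForm

variable {m n : Type*} [Fintype m] [Fintype n]

/-- The real part of `⟨v| M |v⟩`. -/
def reQuad (M : Matrix n n ℂ) (v : n → ℂ) : ℝ := (star v ⬝ᵥ M *ᵥ v).re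

lemma reQuad_mono {M N : Matrix n n ℂ} (h : M ≤ N) (v : n → ℂ) : reQuad M v ≤ reQuad N v := by
  have := (Complex.le_def.1 ((Matrix.le_iff.1 h).dotProduct_mulVec_nonneg v)).1
  rw [Matrix.sub_mulVec, dotProduct_sub] at this
  simpa [reQuad] using this

lemma reQuad_mulVec (M : Matrix m m ℂ) (V : Matrix m n ℂ) (v : n → ℂ) :
    reQuad M (V *ᵥ v) = reQuad (Vᴴ * M * V) v := by
  simp only [reQuad, Matrix.star_mulVec, Matrix.dotProduct_mulVec, Matrix.vecMul_vecMul]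

end QuadraticForm

end Matrix

/-! ### Compression inequality for operator anti-monotone functions -/

namespace IsOperatorAntitone

variable {m n : Type*} [Fintype m] [DecidableEq m] [Fintype n] [DecidableEq n] {f : ℝ → ℝ}

lemma cfc_le_cfc (hf : IsOperatorAntitone f) {A B : Matrix n n ℂ} (hA : A.PosDef)
    (hB : B.PosDef) (h : A ≤ B) : cfc f B ≤ cfc f A := by
  let e := (Fintype.equivFin n).symm
  have hAB : A.submatrix e e ≤ B.submatrix e e :=
    Matrix.le_iff.2 ((Matrix.le_iff.1 h).submatrix e)
  have key := hf _ _ _ (hA.submatrix e.injective) (hB.submatrix e.injective) hAB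
  rw [cfc_submatrix_equiv hA.1, cfc_submatrix_equiv hB.1] at key
  have := (Matrix.le_iff.1 key).submatrix e.symm
  rw [Matrix.le_iff]
  convert this using 1
  ext i j
  simp

lemma le_of_le (hf : IsOperatorAntitone f) {x y : ℝ} (hx : 0 < x) (hxy : x ≤ y) :
    f y ≤ f x := by
  have hpos : ∀ t : ℝ, 0 < t → (algebraMap ℝ (Matrix (Fin 1) (Fin 1) ℂ) t).PosDef := fun t ht => by
    rw [Algebra.algebraMap_eq_smul_one]
    exact Matrix.PosDef.one.smul ht
  have h := hf 1 _ _ (hpos x hx) (hpos y (hx.trans_le hxy)) (by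
    rw [Matrix.le_iff, ← map_sub, Algebra.algebraMap_eq_smul_one]
    exact Matrix.PosSemidef.one.smul (sub_nonneg.2 hxy))
  rw [cfc_algebraMap, cfc_algebraMap, Matrix.le_iff, ← map_sub] at h
  have := h.diag_nonneg (i := 0)
  simpa [Algebra.algebraMap_eq_smul_one, Complex.le_def] using this

/-- Compression by an isometry, up to a scaling of the argument. -/
lemma compression_le_scaled (hf : IsOperatorAntitone f) {V : Matrix m n ℂ} (hV : Vᴴ * V = 1)
    {τ : Matrix m m ℂ} (hτ : τ.PosDef) {w c : ℝ} (hw : 0 < w) (hc : 0 < c) (hc1 : c < 1) :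
    Vᴴ * cfc f (w • τ⁻¹) * V ≤ cfc f (c • w • (Vᴴ * τ * V)⁻¹) := by
  have hinj : Function.Injective V.mulVec := fun x y hxy => by
    have := congrArg (Vᴴ *ᵥ ·) hxy
    simpa [Matrix.mulVec_mulVec, hV] using this
  set N := Vᴴ * τ * V with hN
  have hNp : N.PosDef := hτ.conjTranspose_mul_mul_same hinj
  set D : Matrix m m ℂ := V * Vᴴ - c • 1 with hD
  have hDV : D * V = (1 - c) • V := by
    rw [hD, Matrix.sub_mul, Matrix.mul_assoc, hV, sub_smul]; simp
  have hDh : Dᴴ = D := by simp [hD]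
  -- `σ` dominates `τ` and leaves the range of `V` invariant: as `D V = (1 - c) V`, the correction
  -- sends `V` to `c⁻¹ D τ V = c⁻¹ V N - τ V`, which cancels `τ V`.
  set σ : Matrix m m ℂ := τ + (c * (1 - c))⁻¹ • (D * τ * D) with hσ
  have hc' : 0 < 1 - c := sub_pos.2 hc1
  have hpsd : ((c * (1 - c))⁻¹ • (D * τ * D)).PosSemidef := by
    have := hτ.posSemidef.conjTranspose_mul_mul_same D
    rw [hDh] at this
    exact this.smul (by positivity)
  have hσp : σ.PosDef := hτ.add_posSemidef hpsd
  have hle : τ ≤ σ := by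
    rw [Matrix.le_iff, hσ, add_sub_cancel_left]; exact hpsd
  have hσV : σ * V = V * (c⁻¹ • N) := by
    rw [hσ, Matrix.add_mul, Matrix.smul_mul, Matrix.mul_assoc, hDV, Matrix.mul_smul, smul_smul,
      mul_inv, mul_assoc, inv_mul_cancel₀ hc'.ne', mul_one, hD, Matrix.sub_mul, Matrix.sub_mul,
      smul_sub, Matrix.smul_mul, Matrix.one_mul, Matrix.smul_mul, smul_smul, inv_mul_cancel₀ hc.ne',
      one_smul, hN]
    simp only [Matrix.mul_smul, Matrix.mul_assoc]
    abel
  have hσu : IsUnit σ.det := (Matrix.isUnit_iff_isUnit_det σ).1 hσp.isUnit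
  have hNu : IsUnit N.det := (Matrix.isUnit_iff_isUnit_det N).1 hNp.isUnit
  have hσiV : (w • σ⁻¹) * V = V * (c • w • N⁻¹) := by
    have h1 : V = c⁻¹ • (σ⁻¹ * V * N) := by
      have := congrArg (σ⁻¹ * ·) hσV
      simpa [Matrix.nonsing_inv_mul_cancel_left _ _ hσu, Matrix.mul_assoc] using this
    conv_rhs => rw [h1]
    simp only [Matrix.smul_mul, Matrix.mul_smul, Matrix.mul_nonsing_inv_cancel_right _ _ hNu,
      smul_smul]
    congr 1
    field_simp
  have hle2 : w • σ⁻¹ ≤ w • τ⁻¹ := by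
    rw [Matrix.le_iff, ← smul_sub]
    exact (Matrix.le_iff.1 (hτ.inv_le_inv hσp hle)).smul hw.le
  have hcfc := hf.cfc_le_cfc (hσp.inv.smul hw) (hτ.inv.smul hw) hle2
  have h3 := (Matrix.le_iff.1 hcfc).conjTranspose_mul_mul_same V
  have h4 := cfc_mul_eq_mul_cfc (hσp.inv.smul hw).1 ((hNp.inv.smul hw).smul hc).1 hσiV f
  rw [Matrix.le_iff]
  convert h3 using 1
  rw [Matrix.mul_sub, Matrix.sub_mul, Matrix.mul_assoc Vᴴ (cfc f (w • σ⁻¹)), h4,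
    ← Matrix.mul_assoc, hV, Matrix.one_mul]

end IsOperatorAntitone

/-! ### Left continuity and the limit `c → 1` -/

namespace Matrix

lemma cfc_diagonal_ofReal {n : Type*} [Fintype n] [DecidableEq n] (f : ℝ → ℝ) (d : n → ℝ) :
    cfc f (diagonal fun i => (d i : ℂ)) = diagonal fun i => (f (d i) : ℂ) := by
  have hM : (diagonal fun i => (d i : ℂ)).IsHermitian :=
    Matrix.isHermitian_diagonal_of_self_adjoint _ (by ext i; simp)
  ext k i
  have h : (diagonal fun i => (d i : ℂ)) * Matrix.of (fun k (_ : Fin 1) => if k = i then (1 : ℂ) else 0) =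
      Matrix.of (fun k (_ : Fin 1) => if k = i then (1 : ℂ) else 0) *
        algebraMap ℝ (Matrix (Fin 1) (Fin 1) ℂ) (d i) := by
    ext k j
    fin_cases j
    by_cases hk : k = i <;>
      simp [Matrix.mul_apply, Matrix.diagonal_apply, Matrix.algebraMap_matrix_apply, hk]
  have hN : (algebraMap ℝ (Matrix (Fin 1) (Fin 1) ℂ) (d i)).IsHermitian :=
    Matrix.isHermitian_iff_isSelfAdjoint.2 (IsSelfAdjoint.algebraMap _ (.all _))
  have h2 := cfc_mul_eq_mul_cfc hM hN h f
  rw [cfc_algebraMap] at h2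
  have h3 := congrFun (congrFun h2 k) 0
  by_cases hk : k = i <;>
    simpa [Matrix.mul_apply, Matrix.diagonal_apply, Matrix.algebraMap_matrix_apply, hk] using h3

end Matrix

namespace IsOperatorAntitone

variable {m n : Type*} [Fintype m] [DecidableEq m] [Fintype n] [DecidableEq n] {f : ℝ → ℝ}

/-- Midpoint concavity of `t ↦ f (1/t)` with slack, from compressing `diag(a, b)` by the unit vector
`(1, 1)/√2`. The strict inequality on `t` leaves room for the factor `c = ((a + b)/2)/t < 1`. -/
lemma midpoint_le (hf : IsOperatorAntitone f) {a b t : ℝ} (ha : 0 < a) (hb : 0 < b)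
    (ht : (a + b) / 2 < t) : (f a⁻¹ + f b⁻¹) / 2 ≤ f t⁻¹ := by
  have ht0 : 0 < t := lt_trans (by positivity) ht
  set V : Matrix (Fin 2) (Fin 1) ℂ := Matrix.of fun _ _ => (((√2)⁻¹ : ℝ) : ℂ) with hV
  have h2 : (((√2)⁻¹ : ℝ) : ℂ) * (((√2)⁻¹ : ℝ) : ℂ) = 2⁻¹ := by
    rw [← Complex.ofReal_mul, ← mul_inv, Real.mul_self_sqrt zero_le_two]; simp
  have hquad : ∀ x y : ℝ, Vᴴ * (diagonal fun i => ((![x, y] i : ℝ) : ℂ)) * V =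
      diagonal fun _ => (((x + y) / 2 : ℝ) : ℂ) := fun x y => by
    ext i j
    fin_cases i; fin_cases j
    simp only [hV, Matrix.mul_apply, Matrix.diagonal_apply, Fin.sum_univ_two]
    simp
    rw [Complex.ofReal_inv] at h2
    linear_combination ((x : ℂ) + y) * h2
  have hinv : ∀ (k : ℕ) (d : Fin k → ℝ), (∀ i, 0 < d i) →
      (diagonal fun i => (d i : ℂ))⁻¹ = diagonal fun i => (((d i)⁻¹ : ℝ) : ℂ) := fun k d hd => by
    refine Matrix.inv_eq_right_inv ?_
    rw [Matrix.diagonal_mul_diagonal, ← Matrix.diagonal_one]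
    congr 1
    ext i
    rw [← Complex.ofReal_mul, mul_inv_cancel₀ (hd i).ne']
    simp
  have hV1 : Vᴴ * V = 1 := by
    have := hquad 1 1
    ext i j
    have := congrFun (congrFun this i) j
    fin_cases i; fin_cases j
    simpa [Matrix.mul_apply, Matrix.diagonal_apply, Fin.sum_univ_two] using this
  have hpos : ∀ i, 0 < ![a, b] i := fun i => by fin_cases i <;> simpa
  have hτ : (diagonal fun i => ((![a, b] i : ℝ) : ℂ)).PosDef :=
    Matrix.PosDef.diagonal fun i => by exact_mod_cast hpos i
  have key := hf.compression_le_scaled hV1 hτ (w := 1) (c := (a + b) / 2 / t) one_pos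
    (by positivity) ((div_lt_one ht0).2 ht)
  rw [one_smul, one_smul, hquad, hinv _ _ hpos,
    hinv 1 (fun _ => (a + b) / 2) (fun _ => by positivity), cfc_diagonal_ofReal] at key
  have e1 : ((a + b) / 2 / t) • (diagonal fun _ : Fin 1 => ((((a + b) / 2)⁻¹ : ℝ) : ℂ)) =
      diagonal fun _ : Fin 1 => ((t⁻¹ : ℝ) : ℂ) := by
    rw [← Matrix.diagonal_smul]
    congr 1
    ext i
    simp only [Pi.smul_apply, Complex.real_smul, ← Complex.ofReal_mul]
    congr 1
    field_simp
  have e2 : (fun i => ((f (![a, b] i)⁻¹ : ℝ) : ℂ)) =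
      fun i => ((![f a⁻¹, f b⁻¹] i : ℝ) : ℂ) := by
    ext i; fin_cases i <;> simp
  rw [e1, e2, hquad, cfc_diagonal_ofReal, Matrix.le_iff, Matrix.diagonal_sub] at key
  have := (Complex.le_def.1 (key.diag_nonneg (i := 0))).1
  simpa using this

/-- An upward jump of the monotone function `g t = f (1/t)` at `X = 1/x` would contradict
`midpoint_le`: take `a < X` with `g a` nearly the left limit and `b > X` so that the midpoint stays
below `X`. -/
lemma exists_lt_le_add (hf : IsOperatorAntitone f) {x ε : ℝ} (hx : 0 < x) (hε : 0 < ε) :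
    ∃ y, 0 < y ∧ y < x ∧ f y < f x + ε := by
  set X := x⁻¹ with hX
  have hX0 : 0 < X := by positivity
  set S := (fun t : ℝ => f t⁻¹) '' Set.Ioo 0 X with hS
  have hle : ∀ t, 0 < t → t < X → f t⁻¹ ≤ f x := fun t h0 h1 =>
    hf.le_of_le hx ((le_inv_comm₀ hx h0).2 h1.le)
  have hbdd : BddAbove S := ⟨f x, by rintro _ ⟨t, ⟨h0, h1⟩, rfl⟩; exact hle t h0 h1⟩
  have hne : S.Nonempty := ⟨_, X / 2, ⟨by positivity, by linarith⟩, rfl⟩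
  obtain ⟨_, ⟨a, ⟨ha0, haX⟩, rfl⟩, ha⟩ :=
    exists_lt_of_lt_csSup hne (show sSup S - ε < sSup S by linarith)
  -- Here `t - (a + b)/2 = (X - a)/8 > 0`, while `t < X < b`.
  have h1 := hf.midpoint_le (a := a) (b := (5 * X - a) / 4) (t := (3 * X + a) / 4) ha0
    (by linarith) (by linarith)
  have h2 : f ((3 * X + a) / 4)⁻¹ ≤ sSup S :=
    le_csSup hbdd ⟨_, ⟨by linarith, by linarith⟩, rfl⟩
  have h3 := hle ((3 * X + a) / 4) (by linarith) (by linarith)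
  have hy : 0 < (5 * X - a) / 4 := by linarith
  refine ⟨((5 * X - a) / 4)⁻¹, inv_pos.2 hy, ?_, ?_⟩
  · rw [inv_lt_comm₀ hy hx, ← hX]; linarith
  · simp only at ha
    linarith

lemma tendsto_cfc_smul (hf : IsOperatorAntitone f) {N : Matrix n n ℂ} (hN : N.PosDef) :
    Tendsto (fun c : ℝ => cfc f (c • N)) (𝓝[<] 1) (𝓝 (cfc f N)) := by
  have hspec : ∀ x ∈ spectrum ℝ N, 0 < x := fun x hx =>
    (Matrix.isStrictlyPositive_iff_posDef.2 hN).spectrum_pos hx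
  have hcont : ∀ g : ℝ → ℝ, ContinuousOn g (spectrum ℝ N) := fun g =>
    N.finite_real_spectrum.continuousOn g
  have heq : (fun c : ℝ => cfc f (c • N)) = fun c : ℝ => cfc (fun x => f (c • x)) N := by
    ext1 c
    exact (cfc_comp_smul c f N ((N.finite_real_spectrum.image _).continuousOn f)
      hN.1.isSelfAdjoint).symm
  rw [heq]
  -- On a finite spectrum uniform convergence is pointwise convergence.
  refine tendsto_cfc_fun ?_ (Eventually.of_forall fun c => hcont _)
  rw [Metric.tendstoUniformlyOn_iff]
  intro ε hε
  rw [Filter.eventually_all_finite N.finite_real_spectrum]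
  intro x hx
  have hx0 := hspec x hx
  obtain ⟨y, hy0, hyx, hy⟩ := hf.exists_lt_le_add hx0 hε
  filter_upwards [Ioo_mem_nhdsLT ((div_lt_one hx0).2 hyx)] with c hc
  have h1 : y ≤ c * x := ((div_lt_iff₀ hx0).1 hc.1).le
  have h2 : c * x ≤ x := by nlinarith [hc.2]
  have h3 := hf.le_of_le hy0 h1
  have h4 := hf.le_of_le (hy0.trans_le h1) h2
  rw [Real.dist_eq, abs_lt, smul_eq_mul]
  constructor <;> linarith

lemma reQuad_compression_le (hf : IsOperatorAntitone f) {V : Matrix m n ℂ} (hV : Vᴴ * V = 1)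
    {τ : Matrix m m ℂ} (hτ : τ.PosDef) {w : ℝ} (hw : 0 < w) (v : n → ℂ) :
    reQuad (cfc f (w • τ⁻¹)) (V *ᵥ v) ≤ reQuad (cfc f (w • (Vᴴ * τ * V)⁻¹)) v := by
  have hinj : Function.Injective V.mulVec := fun x y hxy => by
    have := congrArg (Vᴴ *ᵥ ·) hxy
    simpa [Matrix.mulVec_mulVec, hV] using this
  have hN := ((hτ.conjTranspose_mul_mul_same hinj).inv.smul hw)
  have hc : Continuous fun M : Matrix n n ℂ => reQuad M v := by
    unfold reQuad
    exact Complex.continuous_re.comp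
      (continuous_const.dotProduct (continuous_id.matrix_mulVec continuous_const))
  refine ge_of_tendsto ((hc.tendsto _).comp (hf.tendsto_cfc_smul hN)) ?_
  filter_upwards [Ioo_mem_nhdsLT one_pos] with c hc
  rw [reQuad_mulVec]
  exact reQuad_mono (hf.compression_le_scaled hV hτ hw hc.1 hc.2) v

end IsOperatorAntitone

/-! ### Eigenvectors of `Y + ε Π_Y^⊥` -/

namespace Matrix

section Eigen

variable {n : Type*} [Fintype n] [DecidableEq n]

lemma sum_vecMulVec_orthonormalBasis (b : OrthonormalBasis n ℂ (EuclideanSpace ℂ n)) :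
    ∑ i, vecMulVec (b i).ofLp (star (b i).ofLp) = 1 := by
  set U : Matrix n n ℂ := Matrix.of fun k i => b i k with hU
  have h1 : Uᴴ * U = 1 := by
    ext i j
    have := (orthonormal_iff_ite.1 b.orthonormal) i j
    rw [EuclideanSpace.inner_eq_star_dotProduct] at this
    rw [Matrix.one_apply, ← this, dotProduct_comm]
    rfl
  have h2 : U * Uᴴ = 1 := mul_eq_one_comm.1 h1
  rw [← h2]
  ext k l
  simp [Matrix.sum_apply, Matrix.mul_apply, vecMulVec_apply, hU]

/-- The eigenvalues of `Y + ε Π_Y^⊥`. -/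
noncomputable def IsHermitian.shiftedEigenvalues {Y : Matrix n n ℂ} (hY : Y.IsHermitian) (ε : ℝ) (i : n) : ℝ :=
  if hY.eigenvalues i = 0 then ε else hY.eigenvalues i

lemma PosSemidef.shiftedEigenvalues_pos {Y : Matrix n n ℂ} (hY : Y.PosSemidef) {ε : ℝ}
    (hε : 0 < ε) (i : n) : 0 < hY.1.shiftedEigenvalues ε i := by
  unfold IsHermitian.shiftedEigenvalues
  split_ifs with h
  · exact hε
  · exact lt_of_le_of_ne (hY.eigenvalues_nonneg i) (Ne.symm h)

/-- Since `Y` is Hermitian, eigenvectors with nonzero eigenvalue are orthogonal to the kernel. -/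
lemma kerProj_mulVec {Y : Matrix n n ℂ} (hY : Y.IsHermitian) {w : ℝ} {u : n → ℂ}
    (h : Y *ᵥ u = (w : ℂ) • u) : kerProj Y *ᵥ u = if w = 0 then u else 0 := by
  set T := Matrix.toEuclideanCLM (n := n) (𝕜 := ℂ)
  have h1 : kerProj Y *ᵥ u =
      ((LinearMap.ker (T Y).toLinearMap).starProjection (WithLp.toLp 2 u)).ofLp := by
    have : T (kerProj Y) = (LinearMap.ker (T Y).toLinearMap).starProjection := by
      simp [kerProj, T]
    rw [← this]
    rfl
  rw [h1]
  split_ifs with hw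
  · rw [Submodule.starProjection_eq_self_iff.2]
    rw [LinearMap.mem_ker]
    change WithLp.toLp 2 (Y *ᵥ u) = 0
    rw [h, hw]
    simp
  · rw [(Submodule.starProjection_apply_eq_zero_iff _).2]
    · rfl
    rw [Submodule.mem_orthogonal]
    intro x hx
    have hx' : Y *ᵥ x.ofLp = 0 := congrArg WithLp.ofLp (LinearMap.mem_ker.1 hx)
    rw [EuclideanSpace.inner_eq_star_dotProduct]
    have h3 : (w : ℂ) * (u ⬝ᵥ star x.ofLp) = 0 := by
      rw [← smul_eq_mul, ← smul_dotProduct, ← h, dotProduct_comm, dotProduct_mulVec]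
      have : star x.ofLp ᵥ* Y = star (Y *ᵥ x.ofLp) := by rw [star_mulVec, hY.eq]
      rw [this, hx']
      simp
    exact (mul_eq_zero.1 h3).resolve_left (by exact_mod_cast hw)

lemma add_smul_kerProj_mulVec {Y : Matrix n n ℂ} (hY : Y.IsHermitian) {w : ℝ} {u : n → ℂ}
    (h : Y *ᵥ u = (w : ℂ) • u) (ε : ℝ) :
    (Y + (ε : ℂ) • kerProj Y) *ᵥ u = ((if w = 0 then ε else w : ℝ) : ℂ) • u := by
  rw [add_mulVec, smul_mulVec, kerProj_mulVec hY h, h]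
  split_ifs with hw <;> simp [hw]

lemma IsHermitian.mulVec_eigenvectorBasis_ofLp {Y : Matrix n n ℂ} (hY : Y.IsHermitian) (i : n) :
    Y *ᵥ (hY.eigenvectorBasis i).ofLp =
      (hY.eigenvalues i : ℂ) • (hY.eigenvectorBasis i).ofLp := by
  rw [hY.mulVec_eigenvectorBasis i]
  ext k
  simp

end Eigen

end Matrix

/-! ### The divergence as a sum over eigenvectors -/

section Divergence

variable {n J : Type*} [Fintype n] [DecidableEq n] [Fintype J]

/-- `Q̃_f(X‖W; τ)` in terms of a resolution of the identity into eigenvectors of `W`. -/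
lemma optFDivAt_eq_sum (f : ℝ → ℝ) {X W τ : Matrix n n ℂ} (hτ : τ.IsHermitian)
    {u : J → n → ℂ} {w : J → ℝ} (hu : ∑ j, vecMulVec (u j) (star (u j)) = 1)
    (hW : ∀ j, W *ᵥ u j = (w j : ℂ) • u j) :
    optFDivAt f X W τ = ∑ j, reQuad (cfc f (w j • τ⁻¹)) (CFC.sqrt X *ᵥ u j) := by
  have hWH : W.IsHermitian := by
    have : W = ∑ j, (w j : ℂ) • vecMulVec (u j) (star (u j)) := by
      conv_lhs => rw [← Matrix.mul_one W, ← hu, Matrix.mul_sum]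
      simp only [mul_vecMulVec, hW, smul_vecMulVec]
    rw [this, Matrix.IsHermitian, conjTranspose_sum]
    simp [conjTranspose_smul, conjTranspose_vecMulVec]
  -- `S j = I ⊗ |conj (u j)⟩`; the conjugate of `u j` is an eigenvector of `Wᵀ`, so `S j`
  -- intertwines `τ⁻¹ ⊗ Wᵀ` with `w j • τ⁻¹`.
  set S : J → Matrix (n × n) n ℂ := fun j => Matrix.of fun p a =>
    (1 : Matrix n n ℂ) p.1 a * star (u j p.2) with hS
  have hτi : (τ⁻¹).IsHermitian := hτ.inv
  set M := τ⁻¹ ⊗ₖ W.transpose with hM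
  have hMH : M.IsHermitian := by
    rw [hM, Matrix.IsHermitian, conjTranspose_kronecker, hτi.eq, hWH.transpose.eq]
  have hMS : ∀ j, M * S j = S j * (w j • τ⁻¹) := fun j => by
    ext ⟨p, q⟩ a
    have h := congrFun (hW j) q
    have h2 : ∑ x, W x q * star (u j x) = w j * star (u j q) := by
      have := congrArg star h
      simp only [mulVec, dotProduct, star_sum, star_mul', Pi.smul_apply, smul_eq_mul] at this
      rw [show star ((w j : ℂ)) = w j from Complex.conj_ofReal _] at this
      rw [← this]
      refine Finset.sum_congr rfl fun x _ => ?_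
      rw [hWH.apply]
    have h3 : (M * S j) (p, q) a = τ⁻¹ p a * ∑ x, W x q * star (u j x) := by
      simp only [Matrix.mul_apply, hM, hS, Fintype.sum_prod_type, kroneckerMap_apply, of_apply,
        transpose_apply, Matrix.one_apply, Finset.mul_sum]
      rw [Finset.sum_eq_single a]
      · simp [mul_assoc]
      · intro x _ hx; simp [hx]
      · simp
    rw [h3, h2]
    simp [Matrix.mul_apply, hS, Matrix.one_apply]
    ring
  have hMS' : ∀ j, cfc f M * S j = S j * cfc f (w j • τ⁻¹) := fun j =>
    cfc_mul_eq_mul_cfc hMH (hτi.smul (IsSelfAdjoint.all _)) (hMS j) f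
  have hφ : ∀ j, (S j)ᴴ *ᵥ phiVec X = CFC.sqrt X *ᵥ u j := fun j => by
    ext a
    simp only [phiVec, gammaVec, hS, mulVec, dotProduct, Fintype.sum_prod_type, Matrix.one_apply,
      conjTranspose_apply, of_apply, kroneckerMap_apply]
    rw [Finset.sum_eq_single a]
    · simp [mul_comm]
    · intro x _ hx; simp [hx]
    · simp
  have hSS : ∑ j, S j * (S j)ᴴ = 1 := by
    ext ⟨p, q⟩ ⟨p', q'⟩
    have := congrFun (congrFun hu q') q
    rw [Matrix.sum_apply] at this
    simp only [vecMulVec_apply, Pi.star_apply] at this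
    simp only [Matrix.sum_apply, Matrix.mul_apply, conjTranspose_apply, hS, of_apply,
      Matrix.one_apply, star_mul', star_star]
    by_cases hp : p = p'
    · subst hp
      simp [Matrix.one_apply, mul_comm] at this ⊢
      rw [this]
      simp [eq_comm]
    · simp [hp]
  have key : (cfc f M) = ∑ j, S j * cfc f (w j • τ⁻¹) * (S j)ᴴ := by
    conv_lhs => rw [← Matrix.mul_one (cfc f M), ← hSS, Matrix.mul_sum]
    simp only [← Matrix.mul_assoc, hMS']
  rw [optFDivAt, ← hM, key, Matrix.sum_mulVec, dotProduct_sum, Complex.re_sum]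
  refine Finset.sum_congr rfl fun j _ => ?_
  rw [← hφ j, reQuad_mulVec, conjTranspose_conjTranspose]
  rfl

end Divergence

section Divergence

variable {n : Type*} [Fintype n] [DecidableEq n]

lemma optFDivAt_add_smul_kerProj (f : ℝ → ℝ) (X : Matrix n n ℂ) {Y τ : Matrix n n ℂ}
    (hY : Y.IsHermitian) (hτ : τ.IsHermitian) (ε : ℝ) :
    optFDivAt f X (Y + (ε : ℂ) • kerProj Y) τ =
      ∑ i, reQuad (cfc f (hY.shiftedEigenvalues ε i • τ⁻¹))
        (CFC.sqrt X *ᵥ (hY.eigenvectorBasis i).ofLp) :=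
  optFDivAt_eq_sum f hτ (sum_vecMulVec_orthonormalBasis hY.eigenvectorBasis) fun i =>
    add_smul_kerProj_mulVec hY (hY.mulVec_eigenvectorBasis_ofLp i) ε

end Divergence

/-! ### Classical-quantum operators and their blocks -/

section ClassicalQuantum

variable {Z A : Type*} [Fintype Z] [Fintype A] [DecidableEq A]

/-- The isometry `|v⟩ ↦ |z⟩ ⊗ |v⟩`. -/
noncomputable def blockEmbedding (A : Type*) [DecidableEq A] (b : OrthonormalBasis Z ℂ (EuclideanSpace ℂ Z)) (z : Z) :
    Matrix (Z × A) A ℂ :=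
  Matrix.of fun p a => b z p.1 * (1 : Matrix A A ℂ) p.2 a

variable (b : OrthonormalBasis Z ℂ (EuclideanSpace ℂ Z))

lemma blockEmbedding_mul_mul_conjTranspose (z : Z) (M : Matrix A A ℂ) :
    blockEmbedding A b z * M * (blockEmbedding A b z)ᴴ =
      vecMulVec (b z).ofLp (star (b z).ofLp) ⊗ₖ M := by
  ext ⟨z₁, a₁⟩ ⟨z₂, a₂⟩
  simp only [blockEmbedding, Matrix.mul_apply, Matrix.one_apply, conjTranspose_apply, of_apply,
    kroneckerMap_apply, vecMulVec_apply, Pi.star_apply]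
  rw [Finset.sum_eq_single a₂]
  · simp
    ring
  · intro x _ hx; simp [hx.symm]
  · simp

lemma cqOp_eq_sum (X : Z → Matrix A A ℂ) :
    cqOp b X = ∑ z, blockEmbedding A b z * X z * (blockEmbedding A b z)ᴴ := by
  simp only [blockEmbedding_mul_mul_conjTranspose, cqOp]

lemma cqOp_posSemidef {X : Z → Matrix A A ℂ} (hX : ∀ z, (X z).PosSemidef) :
    (cqOp b X).PosSemidef := by
  rw [cqOp_eq_sum]
  exact Matrix.posSemidef_sum _ fun z _ => (hX z).mul_mul_conjTranspose_same _

variable [DecidableEq Z]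

lemma blockEmbedding_conjTranspose_mul (z w : Z) :
    (blockEmbedding A b z)ᴴ * blockEmbedding A b w = if z = w then (1 : Matrix A A ℂ) else 0 := by
  have h := (orthonormal_iff_ite.1 b.orthonormal) z w
  rw [EuclideanSpace.inner_eq_star_dotProduct, dotProduct] at h
  ext a₁ a₂
  have h2 : ((blockEmbedding A b z)ᴴ * blockEmbedding A b w : Matrix A A ℂ) a₁ a₂ =
      (∑ x, b w x * star (b z x)) * (1 : Matrix A A ℂ) a₁ a₂ := by
    simp [blockEmbedding, Matrix.mul_apply, Matrix.one_apply, Fintype.sum_prod_type, mul_comm]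
    split_ifs <;> simp_all
  rw [h2]
  refine (congrArg (· * (1 : Matrix A A ℂ) a₁ a₂) h).trans ?_
  split_ifs <;> simp

lemma blockEmbedding_conjTranspose_mul_self (z : Z) :
    (blockEmbedding A b z)ᴴ * blockEmbedding A b z = (1 : Matrix A A ℂ) := by
  rw [blockEmbedding_conjTranspose_mul, if_pos rfl]

lemma blockEmbedding_mulVec_injective (z : Z) :
    Function.Injective (blockEmbedding A b z).mulVec := fun x y hxy => by
  have := congrArg ((blockEmbedding A b z)ᴴ *ᵥ ·) hxy
  simpa [Matrix.mulVec_mulVec, blockEmbedding_conjTranspose_mul_self] using this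

lemma sum_blockEmbedding_mul_conjTranspose :
    ∑ z, blockEmbedding A b z * (blockEmbedding A b z)ᴴ = (1 : Matrix (Z × A) (Z × A) ℂ) := by
  have h : ∀ z, blockEmbedding A b z * (blockEmbedding A b z)ᴴ =
      vecMulVec (b z).ofLp (star (b z).ofLp) ⊗ₖ (1 : Matrix A A ℂ) := fun z => by
    rw [← blockEmbedding_mul_mul_conjTranspose, Matrix.mul_one]
  rw [← Matrix.one_kronecker_one, ← sum_vecMulVec_orthonormalBasis b]
  ext p q
  simp [h, Matrix.sum_apply, Finset.sum_mul]

lemma cqOp_mul_blockEmbedding (X : Z → Matrix A A ℂ) (z : Z) :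
    cqOp b X * blockEmbedding A b z = blockEmbedding A b z * X z := by
  rw [cqOp_eq_sum, Matrix.sum_mul, Finset.sum_eq_single z]
  · rw [Matrix.mul_assoc, blockEmbedding_conjTranspose_mul_self, Matrix.mul_one]
  · intro w _ hw
    rw [Matrix.mul_assoc, blockEmbedding_conjTranspose_mul, if_neg hw, Matrix.mul_zero]
  · simp

lemma cqOp_posDef {X : Z → Matrix A A ℂ} (hX : ∀ z, (X z).PosDef) : (cqOp b X).PosDef := by
  refine (cqOp_posSemidef b fun z => (hX z).posSemidef).posDef_iff_isUnit.2 ?_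
  refine IsUnit.of_mul_eq_one (cqOp b fun z => (X z)⁻¹) ?_
  conv_lhs => rw [cqOp_eq_sum b fun z => (X z)⁻¹]
  rw [Matrix.mul_sum, ← sum_blockEmbedding_mul_conjTranspose b]
  refine Finset.sum_congr rfl fun z _ => ?_
  rw [← Matrix.mul_assoc, ← Matrix.mul_assoc, cqOp_mul_blockEmbedding,
    Matrix.mul_nonsing_inv_cancel_right _ _ ((Matrix.isUnit_iff_isUnit_det _).1 (hX z).isUnit)]

lemma sum_trace_compression (τ : Matrix (Z × A) (Z × A) ℂ) :
    ∑ z, ((blockEmbedding A b z)ᴴ * τ * blockEmbedding A b z : Matrix A A ℂ).trace = τ.trace := by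
  conv_rhs => rw [← Matrix.mul_one τ, ← sum_blockEmbedding_mul_conjTranspose b, Matrix.mul_sum,
    Matrix.trace_sum]
  refine Finset.sum_congr rfl fun z _ => ?_
  rw [Matrix.mul_assoc, Matrix.trace_mul_comm, Matrix.mul_assoc]

lemma compression_cqOp (X : Z → Matrix A A ℂ) (z : Z) :
    (blockEmbedding A b z)ᴴ * cqOp b X * blockEmbedding A b z = X z := by
  rw [Matrix.mul_assoc, cqOp_mul_blockEmbedding, ← Matrix.mul_assoc,
    blockEmbedding_conjTranspose_mul_self, Matrix.one_mul]

lemma trace_cqOp (X : Z → Matrix A A ℂ) : (cqOp b X).trace = ∑ z, (X z).trace := by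
  rw [← sum_trace_compression b]
  simp only [compression_cqOp]

/-- The embedded eigenbases of the `Y z` diagonalize `cqOp b Y` with the same eigenvalues, so the
shift by `ε` acts blockwise; the embeddings also intertwine the square roots of `cqOp b X` and `X
z`. -/
lemma optFDivAt_cqOp_add_smul_kerProj (f : ℝ → ℝ) {X Y : Z → Matrix A A ℂ}
    (hX : ∀ z, (X z).PosSemidef) (hY : ∀ z, (Y z).PosSemidef)
    {τ : Matrix (Z × A) (Z × A) ℂ} (hτ : τ.IsHermitian) (ε : ℝ) :
    optFDivAt f (cqOp b X) (cqOp b Y + (ε : ℂ) • kerProj (cqOp b Y)) τ =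
      ∑ z, ∑ i, reQuad (cfc f ((hY z).1.shiftedEigenvalues ε i • τ⁻¹))
        (blockEmbedding A b z *ᵥ CFC.sqrt (X z) *ᵥ ((hY z).1.eigenvectorBasis i).ofLp) := by
  have hYp := cqOp_posSemidef b hY
  rw [optFDivAt_eq_sum (J := Z × A) f hτ
    (u := fun j => blockEmbedding A b j.1 *ᵥ ((hY j.1).1.eigenvectorBasis j.2).ofLp)
    (w := fun j => (hY j.1).1.shiftedEigenvalues ε j.2), Fintype.sum_prod_type]
  · refine Finset.sum_congr rfl fun z _ => Finset.sum_congr rfl fun i _ => ?_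
    rw [mulVec_mulVec, sqrt_mul_eq_mul_sqrt (cqOp_posSemidef b hX) (hX z)
      (cqOp_mul_blockEmbedding b X z), mulVec_mulVec]
  · rw [Fintype.sum_prod_type, ← sum_blockEmbedding_mul_conjTranspose b]
    refine Finset.sum_congr rfl fun z _ => ?_
    have h : blockEmbedding A b z * (blockEmbedding A b z)ᴴ = blockEmbedding A b z *
        (∑ i, vecMulVec ((hY z).1.eigenvectorBasis i).ofLp
          (star ((hY z).1.eigenvectorBasis i).ofLp)) * (blockEmbedding A b z)ᴴ := by
      rw [sum_vecMulVec_orthonormalBasis, Matrix.mul_one]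
    rw [h, Matrix.mul_sum, Matrix.sum_mul]
    refine Finset.sum_congr rfl fun i _ => ?_
    rw [star_mulVec, mul_vecMulVec, vecMulVec_mul]
  · rintro ⟨z, i⟩
    refine add_smul_kerProj_mulVec hYp.1 ?_ ε
    dsimp only
    rw [mulVec_mulVec, cqOp_mul_blockEmbedding, ← mulVec_mulVec,
      (hY z).1.mulVec_eigenvectorBasis_ofLp, mulVec_smul]

/-- The divergence of classical-quantum operators at a classical-quantum state is the sum of the
divergences of the blocks. -/
lemma optFDivAt_cqOp (f : ℝ → ℝ) {X Y τ : Z → Matrix A A ℂ}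
    (hX : ∀ z, (X z).PosSemidef) (hY : ∀ z, (Y z).PosSemidef) (hτ : ∀ z, (τ z).PosDef) (ε : ℝ) :
    optFDivAt f (cqOp b X) (cqOp b Y + (ε : ℂ) • kerProj (cqOp b Y)) (cqOp b τ) =
      ∑ z, optFDivAt f (X z) (Y z + (ε : ℂ) • kerProj (Y z)) (τ z) := by
  have hτp := cqOp_posDef b hτ
  rw [optFDivAt_cqOp_add_smul_kerProj b f hX hY hτp.1]
  refine Finset.sum_congr rfl fun z _ => ?_
  rw [optFDivAt_add_smul_kerProj f (X z) (hY z).1 (hτ z).1]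
  refine Finset.sum_congr rfl fun i _ => ?_
  have hu : IsUnit (cqOp b τ).det := (Matrix.isUnit_iff_isUnit_det _).1 hτp.isUnit
  have hu' : IsUnit (τ z).det := (Matrix.isUnit_iff_isUnit_det _).1 (hτ z).isUnit
  have hinv : (cqOp b τ)⁻¹ * blockEmbedding A b z = blockEmbedding A b z * (τ z)⁻¹ := by
    have := congrArg (fun M => (cqOp b τ)⁻¹ * M * (τ z)⁻¹) (cqOp_mul_blockEmbedding b τ z)
    simp only [Matrix.nonsing_inv_mul_cancel_left _ _ hu] at this
    rw [this, ← Matrix.mul_assoc, Matrix.mul_nonsing_inv_cancel_right _ _ hu']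
  have hinv' : ∀ w : ℝ, (w • (cqOp b τ)⁻¹) * blockEmbedding A b z =
      blockEmbedding A b z * (w • (τ z)⁻¹) := fun w => by
    rw [Matrix.smul_mul, hinv, Matrix.mul_smul]
  rw [reQuad_mulVec, Matrix.mul_assoc,
    cfc_mul_eq_mul_cfc (hτp.inv.1.smul (IsSelfAdjoint.all _))
      ((hτ z).inv.1.smul (IsSelfAdjoint.all _)) (hinv' _),
    ← Matrix.mul_assoc, blockEmbedding_conjTranspose_mul_self, Matrix.one_mul]

/-- Replacing `τ` by its normalized diagonal blocks does not decrease the divergence of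
classical-quantum operators. -/
lemma optFDivAt_cqOp_le {f : ℝ → ℝ} (hf : IsOperatorAntitone f) {X Y : Z → Matrix A A ℂ}
    (hX : ∀ z, (X z).PosSemidef) (hY : ∀ z, (Y z).PosSemidef)
    {τ : Matrix (Z × A) (Z × A) ℂ} (hτ : τ.PosDef) {t : ℝ} (ht : 0 < t) (ht1 : t ≤ 1)
    {ε : ℝ} (hε : 0 < ε) :
    optFDivAt f (cqOp b X) (cqOp b Y + (ε : ℂ) • kerProj (cqOp b Y)) τ ≤
      ∑ z, optFDivAt f (X z) (Y z + (ε : ℂ) • kerProj (Y z))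
        (t⁻¹ • ((blockEmbedding A b z)ᴴ * τ * blockEmbedding A b z)) := by
  rw [optFDivAt_cqOp_add_smul_kerProj b f hX hY hτ.1]
  refine Finset.sum_le_sum fun z _ => ?_
  have hN : ((blockEmbedding A b z)ᴴ * τ * blockEmbedding A b z : Matrix A A ℂ).PosDef :=
    hτ.conjTranspose_mul_mul_same (blockEmbedding_mulVec_injective b z)
  have hNt := hN.smul (inv_pos.2 ht)
  rw [optFDivAt_add_smul_kerProj f (X z) (hY z).1 hNt.1]
  refine Finset.sum_le_sum fun i _ => ?_
  have hw := (hY z).shiftedEigenvalues_pos hε i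
  refine (hf.reQuad_compression_le (blockEmbedding_conjTranspose_mul_self b z) hτ hw _).trans ?_
  -- As `t ≤ 1`, normalizing enlarges the block, shrinks its inverse and so raises `f`.
  refine reQuad_mono (hf.cfc_le_cfc (hNt.inv.smul hw) (hN.inv.smul hw) ?_) _
  have hle : (blockEmbedding A b z)ᴴ * τ * blockEmbedding A b z ≤
      t⁻¹ • ((blockEmbedding A b z)ᴴ * τ * blockEmbedding A b z : Matrix A A ℂ) := by
    rw [Matrix.le_iff]
    nth_rw 2 [← one_smul ℝ ((blockEmbedding A b z)ᴴ * τ * blockEmbedding A b z)]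
    rw [← sub_smul]
    exact hN.posSemidef.smul (sub_nonneg.2 ((one_le_inv₀ ht).2 ht1))
  have h := hN.inv_le_inv hNt hle
  rw [Matrix.le_iff, ← smul_sub]
  exact (Matrix.le_iff.1 h).smul hw.le

end ClassicalQuantum

/-! ### Comparison of the two suprema -/

theorem mainTheorem8 {Z A : Type*} [Fintype Z] [DecidableEq Z] [Nonempty Z]
    [Fintype A] [DecidableEq A] [Nonempty A]
    (f : ℝ → ℝ) (hf : IsOperatorAntitone f)
    (b : OrthonormalBasis Z ℂ (EuclideanSpace ℂ Z))
    (X Y : Z → Matrix A A ℂ)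
    (hX : ∀ z, (X z).PosSemidef) (hY : ∀ z, (Y z).PosSemidef) :
    optFDiv f (cqOp b X) (cqOp b Y) =
      ⨆ (τ : Z → Matrix A A ℂ) (ε : ℝ)
        (_ : (∀ z, (τ z).PosDef) ∧ ∑ z, (τ z).trace = 1 ∧ 0 < ε),
        ((∑ z, optFDivAt f (X z) (Y z + (ε : ℂ) • kerProj (Y z)) (τ z) : ℝ) : EReal) := by
  refine le_antisymm (iSup_le fun τ => iSup_le fun ε => iSup_le fun h => ?_)
    (iSup_le fun τ => iSup_le fun ε => iSup_le fun h => ?_)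
  · obtain ⟨hτ, htr, hε⟩ := h
    have htr0 : 0 < τ.trace := hτ.trace_pos
    have ht : 0 < τ.trace.re := (Complex.lt_def.1 htr0).1
    have htre : ((τ.trace.re : ℝ) : ℂ) = τ.trace :=
      Complex.ext rfl (by simpa using (Complex.lt_def.1 htr0).2)
    -- The blocks of `τ` have total trace `Tr τ`; dividing by it meets the constraint `∑ Tr = 1`.
    refine le_iSup_of_le (fun z => τ.trace.re⁻¹ •
      ((blockEmbedding A b z)ᴴ * τ * blockEmbedding A b z)) (le_iSup_of_le ε
        (le_iSup_of_le ⟨fun z => ?_, ?_, hε⟩ ?_))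
    · exact (hτ.conjTranspose_mul_mul_same (blockEmbedding_mulVec_injective b z)).smul
        (inv_pos.2 ht)
    · simp only [Matrix.trace_smul]
      rw [← Finset.smul_sum, sum_trace_compression, ← htre, Complex.real_smul,
        ← Complex.ofReal_mul]
      simp [ht.ne']
    · exact EReal.coe_le_coe_iff.2 (optFDivAt_cqOp_le b hf hX hY hτ ht htr hε)
  · obtain ⟨hτ, htr, hε⟩ := h
    refine le_iSup_of_le (cqOp b τ) (le_iSup_of_le ε
      (le_iSup_of_le ⟨cqOp_posDef b hτ, ?_, hε⟩ ?_))
    · rw [trace_cqOp, htr, Complex.one_re]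
    · rw [optFDivAt_cqOp b f hX hY hτ]
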